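/- **Model.** A message of $k\ge1$ independent equiprobable bits is encoded, by an arbitrary encoder, into $m\ge 1$ uses of a memoryless channel, at rate $R_{ch}=k/m$. Each channel use has $d\ge1$ real dimensions ($d=1$: real channel, $d=2$: complex channel or QPSK), and the noise has power $\sigma_0^2>0$ per channel use. Let $P_R\ge0$ be the received power. The channel is one of the following. * AWGN: independent Gaussian noise of variance $\sigma_0^2/d$ is added in each dimension, and the input power per channel use, averaged over the block and over the messages, is at most $P_R$. * BSC: $d$ parallel binary symmetric channels per channel use, of crossover probability $p=Q\big(\sqrt{P_R/\sigma_0^2}\big)$, where $Q$ is the standard normal tail (antipodal signalling in each dimension with hard decisions). The decoder is a finite graph of processing elements (PEs), each connected to at most $\zeta$ others. Each PE initially stores at most one channel output, and every channel output is stored in some PE. In each of $l$ synchronous iterations every PE exchanges messages with its neighbours and updates its state; messages and update rules are arbitrary (measurable). After $l$ iterations each message bit is read off from the state of a PE assigned to it. The neighbourhood of a bit is the set of channel outputs stored within graph distance $l$ of its PE, and $n$ is the maximum neighbourhood size over all bits. Let $\langle P_e\rangle$ be the bit-error probability averaged over all bits and messages. Each PE uses $E_{node}>0$ joules per iteration and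 a block is decoded in time $k/R_{dec}$ with $R_{dec}>0$, so the decoding power is $P_D=E_{node}\cdot\#\mathrm{PE}\cdot l\cdot R_{dec}/k$. The transmit power is $P_T=\xi_TP_R$, and the weighted total power is $P_{total}=\xi_TP_R+\xi_DP_D$, with $\xi_T,\xi_D>0$. **Statement.** Fix the channel type, $d\ge1$, $\zeta$, $\sigma_0^2$, $\xi_T$, $\xi_D$, $E_{node}$, $R_{dec}$, and the rate $R>0$. Put $\zeta'=\max(\zeta,3)$. Infima below are over all blocklengths, codes, decoders and numbers of iterations with $k/m=R$ and $\langle P_e\rangle\le\varepsilon$ (and equal $\infty$ if there are none). 1. Fix $P\ge0$ and let $n^*(\varepsilon)$, $l^*(\varepsilon)$, $P_D^*(\varepsilon)$ be the infima of $n$, $l$, $P_D$ over designs with transmit power $P_T\le P$. Then $n^*(\varepsilon)$, $l^*(\varepsilon)$ and $P_D^*(\varepsilon)$ tend to $\infty$ as $\varepsilon\to0^+$. Moreover there are constants $c>0$ and $C$, not depending on $\varepsilon$, such that for all $0<\varepsilon<\tfrac12$ $$n^*(\varepsilon)\ge c\log_2\tfrac1\varepsilon-C,\qquad l^*(\varepsilon)\ge\frac{\log_2\log_2\frac1\varepsilon}{\log_2(\zeta'-1)}-C,\qquad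 P_D^*(\varepsilon)\ge\frac{E_{node}R_{dec}}{R}\cdot\frac{\log_2\log_2\frac1\varepsilon}{\log_2(\zeta'-1)}-C.$$ 2. Let $P_{total}^*(\varepsilon)$ be the infimum of $P_{total}$ over all designs, with no restriction on the transmit power. Then $P_{total}^*(\varepsilon)\to\infty$ as $\varepsilon\to0^+$, and there is a constant $C$, not depending on $\varepsilon$, such that for all $0<\varepsilon<\tfrac12$ $$P_{total}^*(\varepsilon)\ge\frac{\xi_DE_{node}R_{dec}}{R}\cdot\frac{\log_2\log_2\frac1\varepsilon}{\log_2(\zeta'-1)}-C.$$ -/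

import Mathlib

open MeasureTheory ProbabilityTheory Filter Topology
open scoped NNReal ENNReal

noncomputable section

/-- The two kinds of real-dimension-wise channel: hard decisions (a binary symmetric channel)
or the unquantized additive white Gaussian noise channel. -/
inductive ChannelKind where
  | bsc
  | awgn

/-- The alphabet (of inputs and of outputs) of one real dimension of the channel. -/
abbrev ChannelKind.Alphabet : ChannelKind → Type
  | .bsc => Bool
  | .awgn => ℝ

instance ChannelKind.measurableSpaceAlphabet : (K : ChannelKind) → MeasurableSpace K.Alphabet
  | .bsc => inferInstanceAs (MeasurableSpace Bool)
  | .awgn => inferInstanceAs (MeasurableSpace ℝ)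

/-- The probability that antipodal signalling at received power `P` against Gaussian noise of
power `σ2` is hard-decided wrongly, that is `Q (√(P / σ2))` with `Q` the standard normal tail.
With `d` real dimensions per channel use each dimension has signal amplitude `√(P / d)` and noise
variance `σ2 / d`, so that the same formula holds for every `d` (QPSK is `d = 2`). -/
def crossover (σ2 P : ℝ) : ℝ :=
  (gaussianReal 0 1).real (Set.Ioi (√(P / σ2)))

/-- The binary symmetric channel with crossover probability `p`: the law of the output. -/
def bscLaw (p : ℝ) (x : Bool) : Measure Bool :=
  ENNReal.ofReal (1 - p) • Measure.dirac x + ENNReal.ofReal p • Measure.dirac (!x)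

/-- The law of the output of one real dimension of the channel, given its input `x`, when there are
`d` real dimensions per channel use, the noise power per channel use is `σ2`, and the received
power is `P`. -/
def ChannelKind.law : (K : ChannelKind) → (d : ℕ) → (σ2 P : ℝ) →
    K.Alphabet → Measure K.Alphabet
  | .bsc, _, σ2, P => fun x => bscLaw (crossover σ2 P) x
  | .awgn, d, σ2, _ => fun x => gaussianReal x (σ2 / d).toNNReal

/-- One channel use consists of `d` real dimensions. -/
abbrev ChannelKind.Sym (K : ChannelKind) (d : ℕ) : Type := Fin d → K.Alphabet

/-- The law of the `m` outputs of the memoryless channel when the codeword `x` is sent. -/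
def ChannelKind.outputLaw (K : ChannelKind) (d : ℕ) (σ2 P : ℝ) {m : ℕ} (x : Fin m → K.Sym d) :
    Measure (Fin m → K.Sym d) :=
  Measure.pi fun j => Measure.pi fun a => K.law d σ2 P (x j a)

/-- The constraint that received power `P` puts on a code with `k` message bits and `m` channel
uses. On the AWGN channel the power per channel use, averaged over the block and over the
equiprobable messages, is at most `P` (a constraint on each single codeword is a special case).
On the BSC the power acts through the crossover probability and no codebook is excluded. -/
def ChannelKind.PowerConstraint : (K : ChannelKind) → (d : ℕ) → (P : ℝ) → {k m : ℕ} →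
    ((Fin k → Bool) → Fin m → K.Sym d) → Prop
  | .bsc, _, _, _, _ => fun _ => True
  | .awgn, _, P, k, m => fun enc =>
      (∑ b : Fin k → Bool, ∑ j, ∑ a, (enc b j a) ^ 2) / ((2 : ℝ) ^ k * m) ≤ P

/-- A message-passing decoder in the VLSI model, for `k` message bits and `m` channel outputs with
values in `Y`: finitely many processing elements, each wired to at most `ζ` others, which in every
iteration send one message along each wire and update their state from their own state and the
messages received. Messages, states and update rules are arbitrary (measurable). -/
structure Decoder (ζ : ℕ) (Y : Type) [MeasurableSpace Y] (k m : ℕ) where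
  /-- the processing elements -/
  PE : Type
  [finitePE : Finite PE]
  /-- the wires -/
  wires : SimpleGraph PE
  degree_le : ∀ v, (wires.neighborSet v).ncard ≤ ζ
  /-- the channel output, if any, that a processing element stores -/
  holds : PE → Option (Fin m)
  holds_surj : ∀ j, ∃ v, holds v = some j
  /-- the processing element in which a message bit is found after decoding -/
  bitPE : Fin k → PE
  State : Type
  [measurableState : MeasurableSpace State]
  Msg : Type
  [measurableMsg : MeasurableSpace Msg]
  /-- the initial state of a processing element that stores no channel output -/
  blank : PE → State
  /-- the initial state of a processing element that stores a channel output -/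
  load : PE → Y → State
  measurable_load : ∀ v, Measurable (load v)
  /-- `send t u v s`: what `u`, being in state `s`, sends to its neighbor `v` in iteration `t` -/
  send : ℕ → PE → PE → State → Msg
  measurable_send : ∀ t u v, Measurable (send t u v)
  /-- `update t v s μ`: the new state of `v` after iteration `t`, from its state and its mail -/
  update : ℕ → (v : PE) → State → (wires.neighborSet v → Msg) → State
  measurable_update : ∀ t v,
    Measurable fun q : State × (wires.neighborSet v → Msg) => update t v q.1 q.2
  /-- how a decoded bit is read off the state of its processing element -/
  readout : Fin k → State → Bool
  measurable_readout : ∀ i, Measurable (readout i)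

attribute [instance] Decoder.finitePE Decoder.measurableState Decoder.measurableMsg

namespace Decoder

variable {ζ : ℕ} {Y : Type} [MeasurableSpace Y] {k m : ℕ}

/-- The state of each processing element after a number of iterations, given the channel outputs. -/
def state (D : Decoder ζ Y k m) (y : Fin m → Y) : ℕ → D.PE → D.State
  | 0, v =>
    match D.holds v with
    | none => D.blank v
    | some j => D.load v (y j)
  | t + 1, v =>
    D.update t v (D.state y t v) fun u : D.wires.neighborSet v => D.send t u v (D.state y t u)

/-- The `i`-th decoded bit after `l` iterations. -/
def decoded (D : Decoder ζ Y k m) (l : ℕ) (y : Fin m → Y) (i : Fin k) : Bool :=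
  D.readout i (D.state y l (D.bitPE i))

/-- The decoding neighborhood of the `i`-th message bit after `l` iterations: the channel outputs
whose processing elements can reach that of the bit, directly or relayed. -/
def neighborhood (D : Decoder ζ Y k m) (l : ℕ) (i : Fin k) : Set (Fin m) :=
  {j | ∃ v, D.holds v = some j ∧ D.wires.edist v (D.bitPE i) ≤ (l : ℕ∞)}

/-- The maximum neighborhood size. -/
def maxNeighborhood (D : Decoder ζ Y k m) (l : ℕ) : ℕ :=
  Finset.univ.sup fun i => (D.neighborhood l i).ncard

end Decoder

/-- A complete design of the link: blocklengths, received power, code, decoder, and number of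
decoding iterations. -/
structure Design (K : ChannelKind) (d ζ : ℕ) where
  /-- number of message bits -/
  k : ℕ
  /-- number of channel uses -/
  m : ℕ
  k_pos : 0 < k
  m_pos : 0 < m
  /-- received power -/
  PR : ℝ≥0
  enc : (Fin k → Bool) → Fin m → K.Sym d
  power : K.PowerConstraint d PR enc
  dec : Decoder ζ (K.Sym d) k m
  /-- number of decoding iterations -/
  iters : ℕ

namespace Design

variable {K : ChannelKind} {d ζ : ℕ}

/-- The rate in bits per channel use. -/
def rate (D : Design K d ζ) : ℝ := D.k / D.m

/-- The maximum neighborhood size `n`. -/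
def nbhd (D : Design K d ζ) : ℕ := D.dec.maxNeighborhood D.iters

/-- The average error probability of the `i`-th message bit, for equiprobable messages. -/
def bitErrorProb (σ2 : ℝ) (D : Design K d ζ) (i : Fin D.k) : ℝ :=
  (∑ b : Fin D.k → Bool,
    (K.outputLaw d σ2 D.PR (D.enc b)).real {y | D.dec.decoded D.iters y i ≠ b i}) / 2 ^ D.k

/-- The average probability of bit error `⟨P_e⟩`. -/
def errorProb (σ2 : ℝ) (D : Design K d ζ) : ℝ :=
  (∑ i, D.bitErrorProb σ2 i) / D.k

/-- The transmit power `P_T = ξ_T P_R`. -/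
def transmitPower (ξT : ℝ) (D : Design K d ζ) : ℝ := ξT * D.PR

/-- The decoding power: every processing element uses `Enode` joules in every iteration, and a
block of `k` bits is decoded in time `T_dec = k / Rdec`. -/
def decodingPower (Enode Rdec : ℝ) (D : Design K d ζ) : ℝ :=
  Enode * Nat.card D.dec.PE * D.iters / (D.k / Rdec)

/-- The weighted total power `ξ_T P_R + ξ_D P_D`. -/
def totalPower (ξT ξD Enode Rdec : ℝ) (D : Design K d ζ) : ℝ :=
  D.transmitPower ξT + ξD * D.decodingPower Enode Rdec

end Design

/-- The infimum of a cost over the designs of rate `R` whose average probability of bit error is at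
most `ε` and whose transmit power is at most `PT` (it is `∞` if there is none). -/
def minCostAtPower (K : ChannelKind) (d ζ : ℕ) (σ2 R ξT PT ε : ℝ)
    (cost : Design K d ζ → ℝ) : ℝ≥0∞ :=
  ⨅ (D : Design K d ζ) (_ : D.rate = R) (_ : D.errorProb σ2 ≤ ε) (_ : D.transmitPower ξT ≤ PT),
    ENNReal.ofReal (cost D)

/-- The maximum neighborhood size required at transmit power `PT` for error probability `ε`. -/
def requiredNeighborhood (K : ChannelKind) (d ζ : ℕ) (σ2 R ξT PT ε : ℝ) : ℝ≥0∞ :=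
  minCostAtPower K d ζ σ2 R ξT PT ε fun D => D.nbhd

/-- The number of iterations required at transmit power `PT` for error probability `ε`. -/
def requiredIterations (K : ChannelKind) (d ζ : ℕ) (σ2 R ξT PT ε : ℝ) : ℝ≥0∞ :=
  minCostAtPower K d ζ σ2 R ξT PT ε fun D => D.iters

/-- The decoding power required at transmit power `PT` for error probability `ε`. -/
def requiredDecodingPower (K : ChannelKind) (d ζ : ℕ) (σ2 R ξT Enode Rdec PT ε : ℝ) : ℝ≥0∞ :=
  minCostAtPower K d ζ σ2 R ξT PT ε fun D => D.decodingPower Enode Rdec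

/-- The minimized weighted total power: the infimum of `ξ_T P_R + ξ_D P_D` over all designs, of
whatever transmit power, that have rate `R` and average probability of bit error at most `ε`. -/
def minTotalPower (K : ChannelKind) (d ζ : ℕ) (σ2 R ξT ξD Enode Rdec ε : ℝ) : ℝ≥0∞ :=
  ⨅ (D : Design K d ζ) (_ : D.rate = R) (_ : D.errorProb σ2 ≤ ε),
    ENNReal.ofReal (D.totalPower ξT ξD Enode Rdec)

end

/-! The proof is a change of measure, exploiting that a decoded bit sees only the outputs in its
neighborhood. Suppose the true output laws `P` are replaced by laws `Q` that, for most messages, are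
dominated with factor `exp (k / 32)` by one message-independent law. No decoder does well under `Q`:
the average bit error is at least 1/256 (`le_sum_measureReal_decoding_error`). For a single bit only
the neighborhood matters, so going back from `Q` to `P` costs the likelihood ratios of at most `n`
outputs, and the true error probability is at least exponentially small in `n`
(`error_lower_bound`).

For the BSC, `Q` is fair coin flipping. For the AWGN channel, an arbitrary code may put much energy
into a few channel uses, where erasing the input would be too costly. Those uses keep their true
law, and the energy budget makes them too few to convey the message; elsewhere `Q` is a centered
Gaussian of half the variance.

In both cases `log (1 / ε)` is at most a constant times `(P + 1) ^ 2 * n` plus a constant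
(`exists_le_exp_mul_errorProb`). Bounded degree makes `n` at most exponential in the number of
iterations, hence the iterated logarithm. There the power enters only through `2 * logb 2 (P + 1)`,
which the linear cost of transmit power absorbs; so free choice of power does not change the leading
coefficient. -/

/-! ### Domination and localization of product measures -/

/-- `OuterMeasure.pi` is the largest outer measure bounded on boxes by the product of the side
measures, so after dividing by the constant it suffices to compare on boxes. -/
theorem pi_le_smul_pi {ι : Type*} [Fintype ι] {α : ι → Type*} [∀ i, MeasurableSpace (α i)]
    (μ ν : ∀ i, Measure (α i)) [∀ i, SigmaFinite (μ i)] [∀ i, SigmaFinite (ν i)]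
    (c : ι → ℝ≥0∞) (hc0 : ∀ i, c i ≠ 0) (hc : ∀ i, c i ≠ ∞) (h : ∀ i, μ i ≤ c i • ν i) :
    Measure.pi μ ≤ (∏ i, c i) • Measure.pi ν := by
  have hC0 : (∏ i, c i) ≠ 0 := Finset.prod_ne_zero_iff.2 fun i _ => hc0 i
  have hC : (∏ i, c i) ≠ ∞ := ENNReal.prod_ne_top fun i _ => hc i
  have key : ((∏ i, c i)⁻¹ • Measure.pi μ).toOuterMeasure ≤
      OuterMeasure.pi fun i => (ν i).toOuterMeasure := by
    rw [OuterMeasure.le_pi]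
    intro s _
    change ((∏ i, c i)⁻¹ • Measure.pi μ) (Set.univ.pi s) ≤ ∏ i, ν i (s i)
    rw [Measure.smul_apply, Measure.pi_pi, smul_eq_mul, ENNReal.inv_mul_le_iff hC0 hC,
      ← Finset.prod_mul_distrib]
    exact Finset.prod_le_prod' fun i _ => h i (s i)
  refine Measure.le_iff.2 fun A hA => ?_
  have h1 := key A
  have h2 : (OuterMeasure.pi fun i => (ν i).toOuterMeasure) A = Measure.pi ν A := by
    rw [Measure.pi, toMeasure_apply _ _ hA]
  rw [h2] at h1
  change ((∏ i, c i)⁻¹ • Measure.pi μ) A ≤ _ at h1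
  rwa [Measure.smul_apply, smul_eq_mul, ENNReal.inv_mul_le_iff hC0 hC] at h1

theorem pi_le_ofReal_exp_smul_pi {ι : Type*} [Fintype ι] {α : ι → Type*}
    [∀ i, MeasurableSpace (α i)]
    (μ ν : ∀ i, Measure (α i)) [∀ i, SigmaFinite (μ i)] [∀ i, SigmaFinite (ν i)]
    (t : ι → ℝ) (h : ∀ i, μ i ≤ ENNReal.ofReal (Real.exp (t i)) • ν i) :
    Measure.pi μ ≤ ENNReal.ofReal (Real.exp (∑ i, t i)) • Measure.pi ν := by
  rw [Real.exp_sum, ENNReal.ofReal_prod_of_nonneg fun i _ => (Real.exp_pos _).le]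
  exact pi_le_smul_pi μ ν _ (fun i => by simp [Real.exp_pos]) (fun i => by simp) h

theorem real_le_of_le_ofReal_smul {α : Type*} [MeasurableSpace α] {μ ν : Measure α}
    [IsFiniteMeasure ν] {c : ℝ} (hc : 0 ≤ c) (h : μ ≤ ENNReal.ofReal c • ν) (s : Set α) :
    μ.real s ≤ c * ν.real s := by
  have h1 := h s
  rw [Measure.smul_apply, smul_eq_mul] at h1
  have h2 := ENNReal.toReal_mono (by finiteness) h1
  rwa [ENNReal.toReal_mul, ENNReal.toReal_ofReal hc] at h2

/-- The event is the preimage of an event in the coordinates of `s`, so only the marginal on `s`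
counts. -/
theorem pi_apply_eq_of_eqOn {ι Y : Type*} [Fintype ι] [MeasurableSpace Y]
    (μ ν : ι → Measure Y) [∀ i, IsProbabilityMeasure (μ i)] [∀ i, IsProbabilityMeasure (ν i)]
    (s : Set ι) (hs : ∀ i ∈ s, μ i = ν i) {A : Set (ι → Y)} (hA : MeasurableSet A)
    (hdep : ∀ y y' : ι → Y, (∀ i ∈ s, y i = y' i) → y ∈ A → y' ∈ A) :
    Measure.pi μ A = Measure.pi ν A := by
  classical
  rcases isEmpty_or_nonempty Y with hY | ⟨⟨y0⟩⟩
  · congr 1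
    congr 1
    funext i
    exact Measure.eq_zero_of_isEmpty _ |>.trans (Measure.eq_zero_of_isEmpty _).symm
  -- The filler `y0` off `s` is harmless, since membership in `A` ignores those coordinates.
  let ext : ({i // i ∈ s} → Y) → ι → Y := fun z i => if h : i ∈ s then z ⟨i, h⟩ else y0
  have hext : Measurable ext := by
    refine measurable_pi_iff.2 fun i => ?_
    by_cases h : i ∈ s
    · simpa [ext, h] using measurable_pi_apply _
    · simp [ext, h]
  have hAB : ∀ ρ : ι → Measure Y, (∀ i, IsProbabilityMeasure (ρ i)) →
      Measure.pi ρ A = Measure.pi (fun i : {i // i ∈ s} => ρ i) (ext ⁻¹' A) := by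
    intro ρ _
    have h1 := (measurePreserving_fst.comp (measurePreserving_piEquivPiSubtypeProd ρ (· ∈ s)))
    rw [← h1.measure_preimage (hext hA).nullMeasurableSet]
    congr 1
    ext y
    have hy : ∀ i ∈ s, y i = ext (fun i : {i // i ∈ s} => y i) i := fun i hi => by
      simp [ext, hi]
    exact ⟨hdep _ _ hy, hdep _ _ fun i hi => (hy i hi).symm⟩
  rw [hAB μ inferInstance, hAB ν inferInstance]
  congr 2
  funext i
  exact hs i i.2

/-! ### Decoding from a nearly uninformative output -/

theorem sum_exp_neg_hammingDist {k : ℕ} (b' : Fin k → Bool) :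
    ∑ b : Fin k → Bool, Real.exp (-(hammingDist b b' : ℝ)) = (1 + Real.exp (-1)) ^ k := by
  have h1 : ∀ b : Fin k → Bool, Real.exp (-(hammingDist b b' : ℝ)) =
      ∏ i, (if b i ≠ b' i then Real.exp (-1) else 1) := by
    intro b
    rw [Finset.prod_ite, Finset.prod_const, Finset.prod_const_one, mul_one, ← Real.exp_nat_mul,
      hammingDist]
    simp
  have h2 := Finset.prod_univ_sum (fun _ : Fin k => (Finset.univ : Finset Bool))
    fun i x => if x ≠ b' i then Real.exp (-1) else 1
  rw [Fintype.piFinset_univ] at h2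
  rw [Finset.sum_congr rfl fun b _ => h1 b, ← h2]
  have h3 : ∀ i, ∑ x : Bool, (if x ≠ b' i then Real.exp (-1) else 1) = 1 + Real.exp (-1) := by
    intro i
    cases b' i <;> simp [add_comm]
  simp only [h3, Finset.prod_const, Finset.card_univ, Fintype.card_fin]

/-- A smooth substitute for "the distance is at least `a` outside a Hamming ball": it replaces
counting the ball by an exponential sum that factorizes over the bits. -/
theorem mul_one_sub_exp_le {a x : ℝ} (ha : 0 ≤ a) (hx : 0 ≤ x) :
    a * (1 - Real.exp (a - x)) ≤ x := by
  rcases le_total a x with h | h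
  · nlinarith [Real.exp_pos (a - x)]
  · nlinarith [Real.one_le_exp (sub_nonneg.2 h)]

/-- Any guess is close to few messages: the sum of `exp (-dist)` over all messages is `(1 + exp
(-1)) ^ k`, exponentially smaller than `2 ^ k`. The factors `exp (k / 32)` from the domination and
from the soft threshold `a = k / 32` together raise it to at most `3 / 4 * 2 ^ k`, which leaves `7 /
8 - 3 / 4 = 1 / 8` of the messages at cost `a`. -/
theorem le_sum_hammingDist {k : ℕ} (hk : 0 < k) (π : (Fin k → Bool) → (Fin k → Bool) → ℝ)
    (π0 : (Fin k → Bool) → ℝ) (hπ : ∀ b b', 0 ≤ π b b') (hπ0 : ∀ b', 0 ≤ π0 b')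
    (hπ1 : ∀ b, ∑ b', π b b' = 1) (hπ01 : ∑ b', π0 b' = 1) (G : Finset (Fin k → Bool))
    (hG : 7 / 8 * 2 ^ k ≤ (G.card : ℝ))
    (hdom : ∀ b ∈ G, ∀ b', π b b' ≤ Real.exp (k / 32) * π0 b') :
    (k : ℝ) * 2 ^ k / 256 ≤ ∑ b, ∑ b', π b b' * (hammingDist b b' : ℝ) := by
  set a : ℝ := k / 32 with ha
  have ha0 : 0 ≤ a := by positivity
  have h1 : ∀ b ∈ G, a * (1 - Real.exp a * Real.exp a * ∑ b', π0 b' *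
      Real.exp (-(hammingDist b b' : ℝ))) ≤ ∑ b', π b b' * (hammingDist b b' : ℝ) := by
    intro b hb
    calc a * (1 - Real.exp a * Real.exp a * ∑ b', π0 b' * Real.exp (-(hammingDist b b' : ℝ)))
        = ∑ b', (a * π b b' - a * (Real.exp a * (Real.exp a * π0 b') *
            Real.exp (-(hammingDist b b' : ℝ)))) := by
          rw [Finset.sum_sub_distrib, ← Finset.mul_sum, hπ1, ← Finset.mul_sum, mul_sub,
            Finset.mul_sum]
          congr 2
          exact Finset.sum_congr rfl fun b' _ => by ring
      _ ≤ ∑ b', π b b' * (a * (1 - Real.exp (a - (hammingDist b b' : ℝ)))) := by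
          refine Finset.sum_le_sum fun b' _ => ?_
          have h := hdom b hb b'
          have e : Real.exp (a - (hammingDist b b' : ℝ)) =
            Real.exp a * Real.exp (-(hammingDist b b' : ℝ)) := by
            rw [← Real.exp_add, sub_eq_add_neg]
          rw [e]
          have h2 : 0 ≤ a * Real.exp a * Real.exp (-(hammingDist b b' : ℝ)) := by positivity
          nlinarith [mul_le_mul_of_nonneg_left h h2]
      _ ≤ _ := by
          refine Finset.sum_le_sum fun b' _ => mul_le_mul_of_nonneg_left ?_ (hπ b b')
          exact mul_one_sub_exp_le ha0 (by positivity)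
  have h2 : ∑ b ∈ G, ∑ b', π0 b' * Real.exp (-(hammingDist b b' : ℝ)) ≤
      (1 + Real.exp (-1)) ^ k := by
    calc ∑ b ∈ G, ∑ b', π0 b' * Real.exp (-(hammingDist b b' : ℝ))
        ≤ ∑ b, ∑ b', π0 b' * Real.exp (-(hammingDist b b' : ℝ)) := by
          refine Finset.sum_le_univ_sum_of_nonneg fun b => ?_
          exact Finset.sum_nonneg fun b' _ => mul_nonneg (hπ0 b') (Real.exp_pos _).le
      _ = ∑ b', π0 b' * ∑ b : Fin k → Bool, Real.exp (-(hammingDist b b' : ℝ)) := by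
          rw [Finset.sum_comm]
          simp_rw [Finset.mul_sum]
      _ = (1 + Real.exp (-1)) ^ k := by
          simp_rw [sum_exp_neg_hammingDist, ← Finset.sum_mul, hπ01, one_mul]
  have h3 : Real.exp a * Real.exp a * (1 + Real.exp (-1)) ^ k ≤ 3 / 4 * 2 ^ k := by
    have e1 : Real.exp a * Real.exp a = Real.exp (1 / 16) ^ k := by
      rw [← Real.exp_add, ← Real.exp_nat_mul, ha]
      congr 1
      ring
    have e2 : Real.exp (1 / 16) ≤ 16 / 15 := by
      have := Real.add_one_le_exp (-(1 / 16) : ℝ)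
      rw [Real.exp_neg] at this
      have hp := Real.exp_pos (1 / 16)
      have h4 := mul_le_mul_of_nonneg_right this hp.le
      rw [inv_mul_cancel₀ hp.ne'] at h4
      linarith
    have e3 : Real.exp (1 / 16) * (1 + Real.exp (-1)) ≤ 3 / 4 * 2 := by
      have := Real.exp_neg_one_lt_d9
      have hp := Real.exp_pos (-1)
      nlinarith
    rw [e1, ← mul_pow]
    calc (Real.exp (1 / 16) * (1 + Real.exp (-1))) ^ k ≤ (3 / 4 * 2) ^ k :=
          pow_le_pow_left₀ (by positivity) e3 k
      _ = (3 / 4) ^ k * 2 ^ k := mul_pow _ _ _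
      _ ≤ 3 / 4 * 2 ^ k := by
          gcongr
          exact pow_le_of_le_one (by norm_num) (by norm_num) hk.ne'
  calc (k : ℝ) * 2 ^ k / 256 = a * (7 / 8 * 2 ^ k - 3 / 4 * 2 ^ k) := by rw [ha]; ring
    _ ≤ a * (G.card - Real.exp a * Real.exp a *
        ∑ b ∈ G, ∑ b', π0 b' * Real.exp (-(hammingDist b b' : ℝ))) := by
      exact mul_le_mul_of_nonneg_left (sub_le_sub hG
        ((mul_le_mul_of_nonneg_left h2 (by positivity)).trans h3)) ha0
    _ = ∑ b ∈ G, a * (1 - Real.exp a * Real.exp a * ∑ b', π0 b' *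
      Real.exp (-(hammingDist b b' : ℝ))) := by
      rw [← Finset.mul_sum, Finset.sum_sub_distrib, ← Finset.mul_sum]
      simp
    _ ≤ ∑ b ∈ G, ∑ b', π b b' * (hammingDist b b' : ℝ) := Finset.sum_le_sum h1
    _ ≤ _ := by
      refine Finset.sum_le_univ_sum_of_nonneg fun b => ?_
      exact Finset.sum_nonneg fun b' _ => mul_nonneg (hπ b b') (by positivity)

theorem le_sum_measureReal_decoding_error {Ω : Type*} [MeasurableSpace Ω] {k : ℕ} (hk : 0 < k)
    (Q : (Fin k → Bool) → Measure Ω) (Q0 : Measure Ω) [∀ b, IsProbabilityMeasure (Q b)]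
    [IsProbabilityMeasure Q0] (dec : Ω → Fin k → Bool) (hdec : Measurable dec)
    (G : Finset (Fin k → Bool)) (hG : 7 / 8 * 2 ^ k ≤ (G.card : ℝ))
    (hdom : ∀ b ∈ G, Q b ≤ ENNReal.ofReal (Real.exp (k / 32)) • Q0) :
    (k : ℝ) * 2 ^ k / 256 ≤ ∑ b, ∑ i, (Q b).real {y | dec y i ≠ b i} := by
  have hsum : ∀ (ρ : Measure Ω) [IsProbabilityMeasure ρ], ∑ b', ρ.real (dec ⁻¹' {b'}) = 1 := by
    intro ρ _
    rw [← probReal_univ (μ := ρ), ← Set.preimage_univ (f := dec)]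
    rw [sum_measureReal_preimage_singleton _ fun b' _ => hdec (measurableSet_singleton b')]
    simp
  have h := le_sum_hammingDist hk (fun b b' => (Q b).real (dec ⁻¹' {b'}))
    (fun b' => Q0.real (dec ⁻¹' {b'})) (fun _ _ => measureReal_nonneg)
    (fun _ => measureReal_nonneg) (fun b => hsum (Q b)) (hsum Q0) G hG fun b hb b' =>
      real_le_of_le_ofReal_smul (Real.exp_pos _).le (hdom b hb) _
  refine h.trans (le_of_eq (Finset.sum_congr rfl fun b _ => ?_))
  have h1 : ∀ i, (Q b).real {y | dec y i ≠ b i} =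
      ∑ b', (Q b).real (dec ⁻¹' {b'}) * (if b i ≠ b' i then 1 else 0) := by
    intro i
    have h2 : {y | dec y i ≠ b i} =
        dec ⁻¹' ((Finset.univ.filter fun b' : Fin k → Bool => b i ≠ b' i : Finset _) : Set _) := by
      ext y
      simp [ne_comm]
    rw [h2, ← sum_measureReal_preimage_singleton _ fun b' _ => hdec (measurableSet_singleton b'),
      Finset.sum_filter]
    simp
  simp_rw [h1]
  rw [Finset.sum_comm]
  refine Finset.sum_congr rfl fun b' _ => ?_
  rw [← Finset.mul_sum, hammingDist, Finset.natCast_card_filter]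

/-! ### Change of measure for local decoders -/

/-- If `S` exceeds `l`, the second term alone is at least 1. Being linear in `S`, the bound can be
averaged over messages, so only the mean cost has to be controlled. -/
theorem le_exp_mul_add_div {q p S l : ℝ} (hq : q ≤ 1) (hp : 0 ≤ p) (hS : 0 ≤ S) (hl : 0 < l)
    (h : q ≤ Real.exp S * p) : q ≤ Real.exp l * p + S / l := by
  rcases le_total S l with h1 | h1
  · have : Real.exp S * p ≤ Real.exp l * p := by gcongr
    have : 0 ≤ S / l := by positivity
    linarith
  · have : 1 ≤ S / l := (one_le_div hl).2 h1
    have : 0 ≤ Real.exp l * p := by positivity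
    linarith

/-- If the decoding of every bit is local and the channel laws `P` are comparable with laws `Q`
under which the output hardly depends on the message, then the error probability is bounded below
exponentially in the size of the neighborhoods. -/
theorem error_lower_bound {Y : Type*} [MeasurableSpace Y] {k m : ℕ} (hk : 0 < k)
    (P Q : (Fin k → Bool) → Fin m → Measure Y) (Q0 : Fin m → Measure Y)
    [∀ b j, IsProbabilityMeasure (P b j)] [∀ b j, IsProbabilityMeasure (Q b j)]
    [∀ j, IsProbabilityMeasure (Q0 j)]
    (dec : (Fin m → Y) → Fin k → Bool) (hdec : Measurable dec) (N : Fin k → Finset (Fin m))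
    (hloc : ∀ i y y', (∀ j ∈ N i, y j = y' j) → dec y i = dec y' i)
    {n : ℕ} (hN : ∀ i, (N i).card ≤ n) (t : (Fin k → Bool) → Fin m → ℝ) (ht : ∀ b j, 0 ≤ t b j)
    (hQP : ∀ b j, Q b j ≤ ENNReal.ofReal (Real.exp (t b j)) • P b j) {τ : ℝ} (hτ0 : 0 ≤ τ)
    (hτ : ∀ j, ∑ b, t b j ≤ 2 ^ k * τ)
    (G : Finset (Fin k → Bool)) (hG : 7 / 8 * 2 ^ k ≤ (G.card : ℝ))
    (hdom : ∀ b ∈ G,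
      Measure.pi (Q b) ≤ ENNReal.ofReal (Real.exp (k / 32)) • Measure.pi Q0) :
    1 / 512 ≤ Real.exp (512 * (n * τ + 1)) *
      ((∑ i, (∑ b, (Measure.pi (P b)).real {y | dec y i ≠ b i}) / 2 ^ k) / k) := by
  classical
  have h1 := le_sum_measureReal_decoding_error hk (fun b => Measure.pi (Q b)) (Measure.pi Q0) dec
    hdec G hG hdom
  have h2 : ∀ b i, (Measure.pi (Q b)).real {y | dec y i ≠ b i} ≤
      Real.exp (∑ j ∈ N i, t b j) * (Measure.pi (P b)).real {y | dec y i ≠ b i} := by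
    intro b i
    have hm : MeasurableSet {y | dec y i ≠ b i} :=
      ((measurable_pi_apply i).comp hdec) (measurableSet_singleton (b i)).compl
    -- Hybrid law: the bit cannot distinguish it from `Q b`, while its comparison with `P b` costs
    -- only the neighborhood factors.
    let Q' : Fin m → Measure Y := fun j => if j ∈ N i then Q b j else P b j
    have hQ' : ∀ j, IsProbabilityMeasure (Q' j) := fun j => by
      by_cases hj : j ∈ N i <;> simp only [Q', hj, if_true, if_false] <;> infer_instance
    have h3 : Measure.pi (Q b) {y | dec y i ≠ b i} = Measure.pi Q' {y | dec y i ≠ b i} := by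
      refine pi_apply_eq_of_eqOn _ _ (N i : Set (Fin m)) ?_ hm ?_
      · intro j hj
        simp [Q', Finset.mem_coe.1 hj]
      · intro y y' hy h
        rw [Set.mem_ofPred_eq] at h ⊢
        rwa [← hloc i y y' fun j hj => hy j (Finset.mem_coe.2 hj)]
    have h4 : Measure.pi Q' ≤ ENNReal.ofReal (Real.exp (∑ j, if j ∈ N i then t b j else 0)) •
        Measure.pi (P b) := by
      refine pi_le_ofReal_exp_smul_pi _ _ _ fun j => ?_
      by_cases hj : j ∈ N i <;> simp only [Q', hj, if_true, if_false]
      · exact hQP b j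
      · simp
    rw [measureReal_def, h3]
    refine (real_le_of_le_ofReal_smul (Real.exp_pos _).le h4 _).trans (le_of_eq ?_)
    congr 2
    rw [Finset.sum_ite_mem, Finset.univ_inter]
  -- This threshold makes the averaged penalty at most 1/512, half of the error 1/256 forced under
  -- `Q`.
  set l : ℝ := 512 * (n * τ + 1) with hl
  have hnτ : 0 ≤ n * τ := by positivity
  have hl0 : 0 < l := by positivity
  have h3 : ∀ b i, (Measure.pi (Q b)).real {y | dec y i ≠ b i} ≤
      Real.exp l * (Measure.pi (P b)).real {y | dec y i ≠ b i} + (∑ j ∈ N i, t b j) / l :=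
    fun b i => le_exp_mul_add_div measureReal_le_one measureReal_nonneg
      (Finset.sum_nonneg fun j _ => ht b j) hl0 (h2 b i)
  have h4 : ∑ b, ∑ i, (∑ j ∈ N i, t b j) / l ≤ k * 2 ^ k / 512 := by
    have h5 : ∀ i, ∑ b, (∑ j ∈ N i, t b j) / l ≤ 2 ^ k / 512 := by
      intro i
      rw [← Finset.sum_div, Finset.sum_comm, div_le_iff₀ hl0]
      calc ∑ j ∈ N i, ∑ b, t b j ≤ ∑ j ∈ N i, 2 ^ k * τ := Finset.sum_le_sum fun j _ => hτ j
        _ = (N i).card * (2 ^ k * τ) := by simp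
        _ ≤ n * (2 ^ k * τ) := by
          have := hN i
          gcongr
        _ ≤ 2 ^ k / 512 * l := by
          rw [hl]
          have : (0 : ℝ) < 2 ^ k := by positivity
          nlinarith
    rw [Finset.sum_comm]
    calc _ ≤ ∑ i : Fin k, (2 : ℝ) ^ k / 512 := Finset.sum_le_sum fun i _ => h5 i
      _ = _ := by simp; ring
  have h5 : (k : ℝ) * 2 ^ k / 256 ≤ Real.exp l *
      (∑ i, ∑ b, (Measure.pi (P b)).real {y | dec y i ≠ b i}) + k * 2 ^ k / 512 := by
    refine h1.trans ((Finset.sum_le_sum fun b _ => Finset.sum_le_sum fun i _ => h3 b i).trans ?_)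
    simp_rw [Finset.sum_add_distrib]
    refine add_le_add (le_of_eq ?_) h4
    rw [Finset.sum_comm]
    simp_rw [Finset.mul_sum]
  rw [← Finset.sum_div, div_div, ← mul_div_assoc, le_div_iff₀ (by positivity)]
  linarith

/-! ### Locality of message passing -/

namespace Decoder

variable {ζ : ℕ} {Y : Type} [MeasurableSpace Y] {k m : ℕ}

theorem measurable_state (D : Decoder ζ Y k m) (t : ℕ) (v : D.PE) :
    Measurable fun y : Fin m → Y => D.state y t v := by
  induction t generalizing v with
  | zero =>
    rcases h : D.holds v with _ | j
    · simp only [state, h]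
      exact measurable_const
    · simp only [state, h]
      exact (D.measurable_load v).comp (measurable_pi_apply j)
  | succ t ih =>
    refine (D.measurable_update t v).comp ((ih v).prodMk (measurable_pi_iff.2 fun u => ?_))
    exact (D.measurable_send t u v).comp (ih u)

theorem measurable_decoded (D : Decoder ζ Y k m) (l : ℕ) :
    Measurable fun y : Fin m → Y => D.decoded l y :=
  measurable_pi_iff.2 fun i => (D.measurable_readout i).comp (D.measurable_state l (D.bitPE i))

/-- Information crosses one wire per iteration: a neighbor's state after `t` iterations depends on
its own ball of radius `t`, which lies in the ball of radius `t + 1`. -/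
theorem state_eq_of_eqOn (D : Decoder ζ Y k m) (y y' : Fin m → Y) (t : ℕ) (v : D.PE)
    (h : ∀ w j, D.holds w = some j → D.wires.edist w v ≤ (t : ℕ∞) → y j = y' j) :
    D.state y t v = D.state y' t v := by
  induction t generalizing v with
  | zero =>
    rcases hv : D.holds v with _ | j
    · simp only [state, hv]
    · simp only [state, hv]
      rw [h v j hv (by simp)]
  | succ t ih =>
    have h1 : D.state y t v = D.state y' t v :=
      ih v fun w j hw hd => h w j hw (hd.trans (by norm_cast; omega))
    have h2 : ∀ u : D.wires.neighborSet v, D.state y t u = D.state y' t u := fun u =>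
      ih u fun w j hw hd => h w j hw (by
        refine (SimpleGraph.edist_triangle (v := (u : D.PE))).trans ?_
        have : D.wires.edist (u : D.PE) v = 1 := SimpleGraph.edist_eq_one_iff_adj.2 u.2.symm
        rw [this]
        push_cast
        gcongr)
    simp only [state, h1, h2]

theorem decoded_eq_of_eqOn (D : Decoder ζ Y k m) (l : ℕ) (i : Fin k) (y y' : Fin m → Y)
    (h : ∀ j ∈ D.neighborhood l i, y j = y' j) : D.decoded l y i = D.decoded l y' i := by
  rw [decoded, decoded, D.state_eq_of_eqOn y y' l _ fun w j hw hd => h j ⟨w, hw, hd⟩]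

theorem le_card_PE (D : Decoder ζ Y k m) : m ≤ Nat.card D.PE := by
  choose f hf using D.holds_surj
  have hinj : Function.Injective f := fun a b hab => by
    have := hf a
    rw [hab, hf b] at this
    exact (Option.some_injective _ this).symm
  simpa using Nat.card_le_card_of_injective f hinj

end Decoder

/-! ### Growth of balls in graphs of bounded degree -/

namespace SimpleGraph

variable {V : Type*} (G : SimpleGraph V)

theorem exists_adj_edist_eq {r v : V} {t : ℕ} (h : G.edist v r = ((t + 1 : ℕ) : ℕ∞)) :
    ∃ u, G.Adj v u ∧ G.edist u r = (t : ℕ∞) := by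
  obtain ⟨p, hp⟩ := G.exists_walk_of_edist_eq_coe h
  cases p with
  | nil => simp at hp
  | @cons _ u _ hadj q =>
    refine ⟨u, hadj, le_antisymm ?_ ?_⟩
    · refine (SimpleGraph.edist_le q).trans ?_
      rw [Walk.length_cons] at hp
      norm_cast
      omega
    · have h1 := SimpleGraph.edist_triangle (G := G) (u := v) (v := u) (w := r)
      rw [h, SimpleGraph.edist_eq_one_iff_adj.2 hadj] at h1
      push_cast at h1
      exact (ENat.add_le_add_iff_left ENat.one_ne_top).1 ((add_comm _ _).trans_le h1)

/-- The vertices at distance `t` from `r`. -/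
def sphere (r : V) (t : ℕ) : Set V := {v | G.edist v r = (t : ℕ∞)}

theorem ncard_sphere_zero (r : V) : (G.sphere r 0).ncard = 1 := by
  have : G.sphere r 0 = {r} := by
    ext v
    simp [sphere]
  rw [this, Set.ncard_singleton]

theorem ncard_sphere_succ_le [Finite V] (r : V) (t a : ℕ)
    (h : ∀ u ∈ G.sphere r t, (G.neighborSet u ∩ G.sphere r (t + 1)).ncard ≤ a) :
    (G.sphere r (t + 1)).ncard ≤ a * (G.sphere r t).ncard := by
  classical
  have : Fintype V := Fintype.ofFinite V
  have hsub : G.sphere r (t + 1) ⊆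
      ⋃ u ∈ (G.sphere r t).toFinset, (G.neighborSet u ∩ G.sphere r (t + 1)) := by
    intro v hv
    obtain ⟨u, hadj, hu⟩ := G.exists_adj_edist_eq hv
    simp only [Set.mem_iUnion]
    exact ⟨u, Set.mem_toFinset.2 hu, hadj.symm, hv⟩
  refine (Set.ncard_le_ncard hsub (Set.toFinite _)).trans ?_
  refine (Finset.set_ncard_biUnion_le _ _).trans ?_
  refine (Finset.sum_le_card_nsmul _ _ a fun u hu => h u (Set.mem_toFinset.1 hu)).trans ?_
  rw [smul_eq_mul, mul_comm, Set.ncard_eq_toFinset_card']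

/-- A vertex other than the center has a neighbor one step closer, so at most `z - 1` neighbors lie
one step farther. The center may have `z`, and the factor 2 covers `z ≤ 2 * (z - 1)`. -/
theorem ncard_sphere_le [Finite V] {z : ℕ} (hz : 3 ≤ z) (hdeg : ∀ v, (G.neighborSet v).ncard ≤ z)
    (r : V) (t : ℕ) : (G.sphere r t).ncard ≤ 2 * (z - 1) ^ t := by
  have h1 : (G.sphere r 1).ncard ≤ z := by
    have := G.ncard_sphere_succ_le r 0 z fun u _ =>
      (Set.ncard_le_ncard Set.inter_subset_left (Set.toFinite _)).trans (hdeg u)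
    rwa [ncard_sphere_zero, mul_one] at this
  rcases t with _ | t
  · rw [ncard_sphere_zero]
    simp
  induction t with
  | zero => simp only [zero_add, pow_one]; omega
  | succ t ih =>
    have h2 := G.ncard_sphere_succ_le r (t + 1) (z - 1) fun u hu => by
      obtain ⟨w, hadj, hw⟩ := G.exists_adj_edist_eq hu
      have h3 : G.neighborSet u ∩ G.sphere r (t + 1 + 1) ⊆ G.neighborSet u \ {w} := by
        rintro v ⟨hv, hv'⟩
        refine ⟨hv, fun hvw => ?_⟩
        rw [Set.mem_singleton_iff] at hvw
        subst hvw
        have h4 := hw.symm.trans hv'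
        norm_cast at h4
        omega
      refine (Set.ncard_le_ncard h3 (Set.toFinite _)).trans ?_
      rw [Set.ncard_sdiff_singleton_of_mem (show w ∈ G.neighborSet u from hadj)]
      have := hdeg u
      omega
    refine h2.trans ((Nat.mul_le_mul_left _ ih).trans (le_of_eq ?_))
    ring

theorem ncard_edist_le [Finite V] {z : ℕ} (hz : 3 ≤ z) (hdeg : ∀ v, (G.neighborSet v).ncard ≤ z)
    (r : V) (l : ℕ) : {v | G.edist v r ≤ (l : ℕ∞)}.ncard ≤ 4 * (z - 1) ^ l := by
  induction l with
  | zero =>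
    have := G.ncard_sphere_zero r
    have h : {v | G.edist v r ≤ ((0 : ℕ) : ℕ∞)} = G.sphere r 0 := by
      ext v
      simp [sphere]
    rw [h, this]
    simp
  | succ l ih =>
    have hsub : {v | G.edist v r ≤ ((l + 1 : ℕ) : ℕ∞)} ⊆
        {v | G.edist v r ≤ (l : ℕ∞)} ∪ G.sphere r (l + 1) := by
      intro v hv
      rcases eq_or_lt_of_le (show G.edist v r ≤ ((l + 1 : ℕ) : ℕ∞) from hv) with h | h
      · exact Or.inr h
      · refine Or.inl ?_
        push_cast at h
        exact (ENat.lt_add_one_iff (by simp)).1 h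
    refine (Set.ncard_le_ncard hsub (Set.toFinite _)).trans ((Set.ncard_union_le _ _).trans ?_)
    refine (add_le_add ih (G.ncard_sphere_le hz hdeg r (l + 1))).trans ?_
    -- Here `3 ≤ z` is essential: spheres must at least double for the ball to be of the order of
    -- its last sphere.
    have : 2 ≤ z - 1 := by omega
    rw [pow_succ]
    nlinarith [Nat.mul_le_mul_left ((z - 1) ^ l) this]

end SimpleGraph

theorem Decoder.ncard_neighborhood_le {ζ : ℕ} {Y : Type} [MeasurableSpace Y] {k m : ℕ}
    (D : Decoder ζ Y k m) (l : ℕ) (i : Fin k) :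
    (D.neighborhood l i).ncard ≤ 4 * (max ζ 3 - 1) ^ l := by
  refine le_trans ?_ (D.wires.ncard_edist_le (le_max_right ζ 3)
    (fun v => (D.degree_le v).trans (le_max_left _ _)) (D.bitPE i) l)
  have h : some '' (D.neighborhood l i) ⊆
      D.holds '' {v | D.wires.edist v (D.bitPE i) ≤ (l : ℕ∞)} := by
    rintro _ ⟨j, ⟨v, hv, hd⟩, rfl⟩
    exact ⟨v, hd, hv⟩
  rw [← Set.ncard_image_of_injective _ (Option.some_injective (Fin m))]
  exact (Set.ncard_le_ncard h (Set.toFinite _)).trans (Set.ncard_image_le (Set.toFinite _))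

theorem Decoder.maxNeighborhood_le {ζ : ℕ} {Y : Type} [MeasurableSpace Y] {k m : ℕ}
    (D : Decoder ζ Y k m) (l : ℕ) : D.maxNeighborhood l ≤ 4 * (max ζ 3 - 1) ^ l :=
  Finset.sup_le fun i _ => D.ncard_neighborhood_le l i

/-! ### Likelihood ratio bounds for single channel outputs -/

theorem gaussianReal_le_of_pdf_le {a b C : ℝ} {v w : ℝ≥0} (hv : v ≠ 0) (hw : w ≠ 0) (hC : 0 ≤ C)
    (h : ∀ y, gaussianPDFReal a v y ≤ C * gaussianPDFReal b w y) :
    gaussianReal a v ≤ ENNReal.ofReal C • gaussianReal b w := by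
  rw [gaussianReal_of_var_ne_zero _ hv, gaussianReal_of_var_ne_zero _ hw,
    ← withDensity_smul _ (measurable_gaussianPDF b w)]
  refine withDensity_mono (Eventually.of_forall fun y => ?_)
  rw [Pi.smul_apply, smul_eq_mul, gaussianPDF, gaussianPDF, ← ENNReal.ofReal_mul hC]
  exact ENNReal.ofReal_le_ofReal (h y)

/-- With equal variances the ratio is unbounded in `y` unless `x = 0`. Halving the variance leaves
the perfect square `(y + x) ^ 2 / (2 * v)` in the exponent, with the favorable sign; the
normalizations contribute `√2 ≤ exp 1`. -/
theorem gaussianReal_zero_half_le {x : ℝ} {v : ℝ≥0} (hv : v ≠ 0) :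
    gaussianReal 0 (v / 2) ≤ ENNReal.ofReal (Real.exp (1 + x ^ 2 / v)) • gaussianReal x v := by
  have hv0 : (0 : ℝ) < v := by positivity
  refine gaussianReal_le_of_pdf_le (by positivity) hv (Real.exp_pos _).le fun y => ?_
  rw [gaussianPDFReal, gaussianPDFReal]
  have h1 : (√(2 * Real.pi * (v / 2 : ℝ≥0)))⁻¹ ≤ Real.exp 1 * (√(2 * Real.pi * v))⁻¹ := by
    rw [← div_eq_mul_inv, le_div_iff₀ (by positivity), mul_comm, ← div_eq_mul_inv,
      ← Real.sqrt_div (by positivity)]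
    have : 2 * Real.pi * (v : ℝ) / (2 * Real.pi * (v / 2 : ℝ≥0)) = 2 := by
      push_cast
      field_simp
    rw [this]
    have := Real.add_one_le_exp 1
    exact (Real.sqrt_le_sqrt (show (2 : ℝ) ≤ 2 ^ 2 by norm_num)).trans
      (by rw [Real.sqrt_sq (by norm_num)]; linarith)
  have h2 : Real.exp (-(y - 0) ^ 2 / (2 * (v / 2 : ℝ≥0))) ≤
      Real.exp (x ^ 2 / v) * Real.exp (-(y - x) ^ 2 / (2 * v)) := by
    rw [← Real.exp_add, Real.exp_le_exp]
    push_cast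
    have : x ^ 2 / v + -(y - x) ^ 2 / (2 * v) - -(y - 0) ^ 2 / (2 * (v / 2)) =
        (y + x) ^ 2 / (2 * v) := by
      field_simp
      ring
    have : 0 ≤ (y + x) ^ 2 / (2 * (v : ℝ)) := by positivity
    linarith
  refine (mul_le_mul h1 h2 (Real.exp_pos _).le (by positivity)).trans (le_of_eq ?_)
  rw [Real.exp_add]
  ring

/-- Widening the dominating Gaussian again completes a square. A larger `α` makes the input energy
cheaper at the price `α / 2` per dimension. -/
theorem gaussianReal_le_zero_mul {x : ℝ} {v α : ℝ≥0} (hv : v ≠ 0) (hα : α ≠ 0) :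
    gaussianReal x v ≤ ENNReal.ofReal (Real.exp (α / 2 + x ^ 2 / (2 * α * v))) •
      gaussianReal 0 ((1 + α) * v) := by
  have hv0 : (0 : ℝ) < v := by positivity
  have hα0 : (0 : ℝ) < α := by positivity
  refine gaussianReal_le_of_pdf_le hv (by positivity) (Real.exp_pos _).le fun y => ?_
  rw [gaussianPDFReal, gaussianPDFReal]
  have h1 : (√(2 * Real.pi * v))⁻¹ ≤
      Real.exp (α / 2) * (√(2 * Real.pi * ((1 + α) * v : ℝ≥0)))⁻¹ := by
    rw [← div_eq_mul_inv, le_div_iff₀ (by positivity), mul_comm, ← div_eq_mul_inv,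
      ← Real.sqrt_div (by positivity)]
    have : 2 * Real.pi * (((1 + α) * v : ℝ≥0) : ℝ) / (2 * Real.pi * v) = 1 + α := by
      push_cast
      field_simp
    rw [this, Real.sqrt_le_left (Real.exp_pos _).le, ← Real.exp_nat_mul]
    have := Real.add_one_le_exp (α : ℝ)
    push_cast
    rw [mul_div_cancel₀ _ (by norm_num : (2 : ℝ) ≠ 0)]
    linarith
  have h2 : Real.exp (-(y - x) ^ 2 / (2 * v)) ≤
      Real.exp (x ^ 2 / (2 * α * v)) * Real.exp (-(y - 0) ^ 2 / (2 * ((1 + α) * v : ℝ≥0))) := by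
    rw [← Real.exp_add, Real.exp_le_exp]
    push_cast
    have : x ^ 2 / (2 * α * v) + -(y - 0) ^ 2 / (2 * ((1 + α) * v)) - -(y - x) ^ 2 / (2 * v) =
        ((1 + α) * x - α * y) ^ 2 / (2 * α * (1 + α) * v) := by
      field_simp
      ring
    have : 0 ≤ ((1 + α) * x - α * y) ^ 2 / (2 * α * (1 + α) * (v : ℝ)) := by positivity
    linarith
  refine (mul_le_mul h1 h2 (Real.exp_pos _).le (by positivity)).trans (le_of_eq ?_)
  rw [Real.exp_add]
  ring

/-- The interval has unit length and the density on it is at least its value at `c`, with `√(2π) ≤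
exp 1`. -/
theorem exp_le_gaussianReal_Ioc {a c : ℝ} (h0 : ∀ y ∈ Set.Ioc a (a + 1), |y| ≤ c) :
    Real.exp (-(c ^ 2 / 2 + 1)) ≤ (gaussianReal 0 1).real (Set.Ioc a (a + 1)) := by
  have hc : Real.exp (-(c ^ 2 / 2 + 1)) =
      ∫ _ in Set.Ioc a (a + 1), Real.exp (-(c ^ 2 / 2 + 1)) := by
    simp
  rw [measureReal_def, gaussianReal_apply_eq_integral _ one_ne_zero,
    ENNReal.toReal_ofReal (integral_nonneg fun y => gaussianPDFReal_nonneg _ _ _), hc]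
  refine setIntegral_mono_on (by simp) (integrable_gaussianPDFReal 0 1).integrableOn
    measurableSet_Ioc fun y hy => ?_
  rw [gaussianPDFReal, neg_add, Real.exp_add, mul_comm]
  have hy2 : y ^ 2 ≤ c ^ 2 := sq_le_sq.2 ((h0 y hy).trans (le_abs_self c))
  refine mul_le_mul ?_ ?_ (Real.exp_pos _).le (by positivity)
  · rw [Real.exp_neg]
    refine inv_anti₀ (by positivity) ((Real.sqrt_le_left (Real.exp_pos _).le).2 ?_)
    have := Real.exp_one_gt_d9
    have := Real.pi_lt_d2
    push_cast
    nlinarith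
  · rw [Real.exp_le_exp]
    push_cast
    linarith

theorem exp_le_crossover {σ2 P : ℝ} (hσ : 0 < σ2) (hP : 0 ≤ P) :
    Real.exp (-(P / σ2 + 2)) ≤ crossover σ2 P := by
  have hx : 0 ≤ √(P / σ2) := Real.sqrt_nonneg _
  have hx2 : √(P / σ2) ^ 2 = P / σ2 := Real.sq_sqrt (by positivity)
  refine le_trans ?_ ((exp_le_gaussianReal_Ioc (a := √(P / σ2)) (c := √(P / σ2) + 1) ?_).trans
    (measureReal_mono Set.Ioc_subset_Ioi_self))
  · rw [Real.exp_le_exp]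
    nlinarith [sq_nonneg (√(P / σ2) - 1)]
  · intro y hy
    rw [abs_of_pos (hx.trans_lt hy.1)]
    exact hy.2

theorem exp_le_one_sub_crossover {σ2 P : ℝ} (hσ : 0 < σ2) (hP : 0 ≤ P) :
    Real.exp (-(P / σ2 + 2)) ≤ 1 - crossover σ2 P := by
  have hx : 0 ≤ √(P / σ2) := Real.sqrt_nonneg _
  have h2 : 1 - crossover σ2 P = (gaussianReal 0 1).real (Set.Iic (√(P / σ2))) := by
    rw [← Set.compl_Ioi, probReal_compl_eq_one_sub measurableSet_Ioi, crossover]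
  rw [h2]
  refine le_trans ?_ ((exp_le_gaussianReal_Ioc (a := -1) (c := 1) ?_).trans
    (measureReal_mono fun y hy => ?_))
  · rw [Real.exp_le_exp]
    have : 0 ≤ P / σ2 := by positivity
    linarith
  · intro y hy
    rw [abs_le]
    constructor <;> linarith [hy.1, hy.2]
  · simp only [Set.mem_Iic]
    have := hy.2
    linarith

theorem isProbabilityMeasure_bscLaw {p : ℝ} (h0 : 0 ≤ p) (h1 : p ≤ 1) (x : Bool) :
    IsProbabilityMeasure (bscLaw p x) := by
  constructor
  rw [bscLaw, Measure.add_apply, Measure.smul_apply, Measure.smul_apply, measure_univ,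
    measure_univ, smul_eq_mul, smul_eq_mul, mul_one, mul_one,
    ← ENNReal.ofReal_add (sub_nonneg.2 h1) h0]
  simp

/-- Both outputs have probability at least `exp (-s)`, so the factor `exp s` lifts each above 1/2.
-/
theorem bscLaw_half_le {p s : ℝ} (h0 : Real.exp (-s) ≤ p) (h1 : Real.exp (-s) ≤ 1 - p)
    (x : Bool) : bscLaw (1 / 2) false ≤ ENNReal.ofReal (Real.exp s) • bscLaw p x := by
  have key : ∀ q, Real.exp (-s) ≤ q →
      ENNReal.ofReal (1 / 2) ≤ ENNReal.ofReal (Real.exp s) * ENNReal.ofReal q := by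
    intro q hq
    rw [← ENNReal.ofReal_mul (Real.exp_pos _).le]
    refine ENNReal.ofReal_le_ofReal ?_
    calc (1 / 2 : ℝ) ≤ Real.exp s * Real.exp (-s) := by
          rw [← Real.exp_add]
          norm_num
      _ ≤ _ := by gcongr
  have e : (1 : ℝ) - 1 / 2 = 1 / 2 := by norm_num
  refine Measure.le_iff.2 fun A _ => ?_
  cases x <;>
  · simp only [bscLaw, Measure.add_apply, Measure.smul_apply, smul_eq_mul, mul_add, ← mul_assoc, e,
      Bool.not_false, Bool.not_true]
    first
    | exact add_le_add (mul_le_mul_left (key _ h1) _) (mul_le_mul_left (key _ h0) _)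
    | rw [add_comm]
      exact add_le_add (mul_le_mul_left (key _ h1) _) (mul_le_mul_left (key _ h0) _)

theorem ChannelKind.isProbabilityMeasure_law (K : ChannelKind) (d : ℕ) {σ2 P : ℝ} (hσ : 0 < σ2)
    (hP : 0 ≤ P) (x : K.Alphabet) : IsProbabilityMeasure (K.law d σ2 P x) := by
  cases K with
  | bsc =>
    have h0 := exp_le_crossover hσ hP
    have h1 := exp_le_one_sub_crossover hσ hP
    have := Real.exp_pos (-(P / σ2 + 2))
    exact isProbabilityMeasure_bscLaw (by linarith) (by linarith) x
  | awgn => exact inferInstanceAs (IsProbabilityMeasure (gaussianReal _ _))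

/-! ### Error bounds for the two channels -/

theorem Design.errorProb_lower_bound {K : ChannelKind} {d ζ : ℕ} {σ2 : ℝ} (hσ : 0 < σ2)
    (D : Design K d ζ)
    (Q : (Fin D.k → Bool) → Fin D.m → Measure (K.Sym d)) (Q0 : Fin D.m → Measure (K.Sym d))
    [∀ b j, IsProbabilityMeasure (Q b j)] [∀ j, IsProbabilityMeasure (Q0 j)]
    (t : (Fin D.k → Bool) → Fin D.m → ℝ) (ht : ∀ b j, 0 ≤ t b j)
    (hQP : ∀ b j, Q b j ≤ ENNReal.ofReal (Real.exp (t b j)) •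
      Measure.pi fun a => K.law d σ2 D.PR (D.enc b j a)) {τ : ℝ} (hτ0 : 0 ≤ τ)
    (hτ : ∀ j, ∑ b, t b j ≤ 2 ^ D.k * τ)
    (G : Finset (Fin D.k → Bool)) (hG : 7 / 8 * 2 ^ D.k ≤ (G.card : ℝ))
    (hdom : ∀ b ∈ G,
      Measure.pi (Q b) ≤ ENNReal.ofReal (Real.exp (D.k / 32)) • Measure.pi Q0) :
    1 / 512 ≤ Real.exp (512 * (D.nbhd * τ + 1)) * D.errorProb σ2 := by
  classical
  have hlaw : ∀ b j a, IsProbabilityMeasure (K.law d σ2 D.PR (D.enc b j a)) := fun b j a =>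
    K.isProbabilityMeasure_law d hσ D.PR.2 _
  refine error_lower_bound D.k_pos
    (fun b j => Measure.pi fun a => K.law d σ2 D.PR (D.enc b j a)) Q Q0
    (fun y => D.dec.decoded D.iters y) (D.dec.measurable_decoded D.iters)
    (fun i => (Set.toFinite (D.dec.neighborhood D.iters i)).toFinset) ?_ ?_ t ht hQP hτ0 hτ G hG
    hdom
  · exact fun i y y' h => D.dec.decoded_eq_of_eqOn D.iters i y y' fun j hj => h j (by simpa using hj)
  · intro i
    rw [← Set.ncard_eq_toFinset_card]
    exact Finset.le_sup (f := fun i => (D.dec.neighborhood D.iters i).ncard) (Finset.mem_univ i)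

theorem Design.errorProb_lower_bound_bsc {d ζ : ℕ} {σ2 : ℝ} (hσ : 0 < σ2)
    (D : Design .bsc d ζ) :
    1 / 512 ≤ Real.exp (512 * (D.nbhd * (d * (D.PR / σ2 + 2)) + 1)) * D.errorProb σ2 := by
  have hhalf : IsProbabilityMeasure (bscLaw (1 / 2) false) :=
    isProbabilityMeasure_bscLaw (by norm_num) (by norm_num) _
  have hlaw : ∀ x, IsProbabilityMeasure (bscLaw (crossover σ2 D.PR) x) := fun x =>
    ChannelKind.bsc.isProbabilityMeasure_law d hσ D.PR.2 x
  have hτ0 : (0 : ℝ) ≤ d * (D.PR / σ2 + 2) := by positivity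
  refine D.errorProb_lower_bound hσ (fun _ _ => Measure.pi fun _ => bscLaw (1 / 2) false)
    (fun _ => Measure.pi fun _ => bscLaw (1 / 2) false) (fun _ _ => d * (D.PR / σ2 + 2))
    (fun _ _ => hτ0) ?_ hτ0 ?_ Finset.univ ?_ ?_
  · intro b j
    have h := pi_le_ofReal_exp_smul_pi (fun _ : Fin d => bscLaw (1 / 2) false)
      (fun a => bscLaw (crossover σ2 D.PR) (D.enc b j a)) (fun _ => D.PR / σ2 + 2) fun a =>
        bscLaw_half_le (exp_le_crossover hσ D.PR.2) (exp_le_one_sub_crossover hσ D.PR.2) _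
    rw [Finset.sum_const, Finset.card_univ, Fintype.card_fin, nsmul_eq_mul] at h
    exact h
  · intro j
    simp
  · simp
    have : (0 : ℝ) < 2 ^ D.k := by positivity
    linarith
  · intro b _
    refine Measure.le_iff.2 fun A _ => ?_
    rw [Measure.smul_apply, smul_eq_mul]
    refine le_mul_of_one_le_left (zero_le) ?_
    rw [ENNReal.one_le_ofReal]
    exact Real.one_le_exp (by positivity)

theorem pi_gaussianReal_zero_half_le {d : ℕ} {v : ℝ≥0} (hv : v ≠ 0) (x : Fin d → ℝ) :
    (Measure.pi fun _ : Fin d => gaussianReal 0 (v / 2)) ≤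
      ENNReal.ofReal (Real.exp (d + (∑ a, x a ^ 2) / v)) •
        Measure.pi fun a => gaussianReal (x a) v := by
  have h := pi_le_ofReal_exp_smul_pi (fun _ : Fin d => gaussianReal 0 (v / 2))
    (fun a => gaussianReal (x a) v) (fun a => 1 + x a ^ 2 / v) fun a =>
      gaussianReal_zero_half_le hv
  rwa [Finset.sum_add_distrib, ← Finset.sum_div, Finset.sum_const, Finset.card_univ,
    Fintype.card_fin, nsmul_eq_mul, mul_one] at h

theorem pi_gaussianReal_le_zero_mul {d : ℕ} {v α : ℝ≥0} (hv : v ≠ 0) (hα : α ≠ 0)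
    (x : Fin d → ℝ) :
    (Measure.pi fun a => gaussianReal (x a) v) ≤
      ENNReal.ofReal (Real.exp (d * (α / 2) + (∑ a, x a ^ 2) / (2 * α * v))) •
        Measure.pi fun _ : Fin d => gaussianReal 0 ((1 + α) * v) := by
  have h := pi_le_ofReal_exp_smul_pi (fun a => gaussianReal (x a) v)
    (fun _ : Fin d => gaussianReal 0 ((1 + α) * v))
    (fun a => α / 2 + x a ^ 2 / (2 * α * v)) fun a => gaussianReal_le_zero_mul hv hα
  rwa [Finset.sum_add_distrib, Finset.sum_const, Finset.card_univ, Fintype.card_fin,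
    nsmul_eq_mul, ← Finset.sum_div] at h

/-- Markov's inequality for a finite sum. -/
theorem card_filter_lt_mul_le {ι : Type*} [Fintype ι] {f : ι → ℝ} (hf : ∀ i, 0 ≤ f i) {T S : ℝ}
    (hS : ∑ i, f i ≤ S) : ((Finset.univ.filter fun i => T < f i).card : ℝ) * T ≤ S := by
  calc ((Finset.univ.filter fun i => T < f i).card : ℝ) * T
      = ∑ i ∈ Finset.univ.filter fun i => T < f i, T := by simp
    _ ≤ ∑ i ∈ Finset.univ.filter fun i => T < f i, f i :=
      Finset.sum_le_sum fun i hi => (Finset.mem_filter.1 hi).2.le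
    _ ≤ ∑ i, f i := Finset.sum_le_univ_sum_of_nonneg hf
    _ ≤ S := hS

theorem Design.errorProb_lower_bound_awgn {d ζ : ℕ} (hd : 1 ≤ d) {σ2 R : ℝ} (hσ : 0 < σ2)
    (hR : 0 < R) (D : Design .awgn d ζ) (hrate : D.rate = R) :
    1 / 512 ≤ Real.exp (512 * (D.nbhd *
      (d + 8192 * d * (D.PR + 1) ^ 2 / ((σ2 / d) * R) ^ 2) + 1)) * D.errorProb σ2 := by
  classical
  set P := (D.PR : ℝ)
  have hP0 : 0 ≤ P := D.PR.2
  have hd0 : (0 : ℝ) < d := by exact_mod_cast hd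
  set v : ℝ≥0 := (σ2 / d).toNNReal with hvdef
  have hvr : (v : ℝ) = σ2 / d := Real.coe_toNNReal _ (by positivity)
  have hv0 : (0 : ℝ) < v := by rw [hvr]; positivity
  have hv : v ≠ 0 := by exact_mod_cast hv0.ne'
  have hm0 : (0 : ℝ) < D.m := by exact_mod_cast D.m_pos
  have hk : (D.k : ℝ) = R * D.m := by rw [← hrate, Design.rate]; field_simp
  have h2k : (0 : ℝ) < 2 ^ D.k := by positivity
  let E : (Fin D.k → Bool) → Fin D.m → ℝ := fun b j => ∑ a, (D.enc b j a : ℝ) ^ 2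
  have hE : ∀ b j, 0 ≤ E b j := fun b j => Finset.sum_nonneg fun a _ => sq_nonneg _
  have hpow : ∑ b, ∑ j, E b j ≤ P * (2 ^ D.k * D.m) := by
    have h : (∑ b, ∑ j, E b j) / (2 ^ D.k * D.m) ≤ P := D.power
    rwa [div_le_iff₀ (by positivity)] at h
  -- Chosen so that total codeword energy `8 * m * (P + 1)` costs `R * m / 64 = k / 64` in the
  -- exponent. Using `P + 1` keeps `α` positive at zero power.
  let α : ℝ≥0 := (256 * (P + 1) / (v * R)).toNNReal
  have hα : (α : ℝ) = 256 * (P + 1) / (v * R) := Real.coe_toNNReal _ (by positivity)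
  have hα0 : (0 : ℝ) < α := by rw [hα]; positivity
  have hα' : α ≠ 0 := by exact_mod_cast hα0.ne'
  -- Chosen so that, by Markov, the uses with mean energy above `T` are few enough for their `α / 2`
  -- terms to cost another `k / 64`; together this is the permitted `k / 32`.
  let T : ℝ := 32 * d * α * (P + 1) / R
  have hT : 0 < T := by positivity
  let H : Finset (Fin D.m) := Finset.univ.filter fun j => T * 2 ^ D.k < ∑ b, E b j
  have hH : (H.card : ℝ) * (d * (α / 2)) ≤ R * D.m / 64 := by
    have h := card_filter_lt_mul_le (f := fun j => ∑ b, E b j) (T := T * 2 ^ D.k)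
      (S := P * (2 ^ D.k * D.m))
      (fun j => Finset.sum_nonneg fun b _ => hE b j) (by rw [Finset.sum_comm]; exact hpow)
    have h' : (H.card : ℝ) * T ≤ P * D.m := by
      have h1 : ((H.card : ℝ) * T) * 2 ^ D.k ≤ (P * D.m) * 2 ^ D.k := by linarith
      exact le_of_mul_le_mul_right h1 h2k
    have h2 : (H.card : ℝ) * T = (H.card * (d * (α / 2))) * (64 * (P + 1) / R) := by
      simp only [T]
      ring
    rw [h2] at h'
    have h3 : (H.card * (d * (α / 2))) * (64 * (P + 1) / R) ≤
        (R * D.m / 64) * (64 * (P + 1) / R) := by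
      refine h'.trans ?_
      have : (R * D.m / 64) * (64 * (P + 1) / R) = (P + 1) * D.m := by field_simp
      rw [this]
      gcongr
      linarith
    exact le_of_mul_le_mul_right h3 (by positivity)
  -- Messages of energy at most 8 times the budget: Markov leaves 7/8 of them.
  let G : Finset (Fin D.k → Bool) :=
    Finset.univ.filter fun b => ¬ 8 * (D.m * (P + 1)) < ∑ j, E b j
  have hG : 7 / 8 * 2 ^ D.k ≤ (G.card : ℝ) := by
    have h := card_filter_lt_mul_le (f := fun b => ∑ j, E b j) (T := 8 * (D.m * (P + 1)))
      (fun b => Finset.sum_nonneg fun j _ => hE b j) hpow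
    have h1 := Finset.card_filter_add_card_filter_not (s := (Finset.univ : Finset (Fin D.k → Bool)))
      (fun b => 8 * (D.m * (P + 1)) < ∑ j, E b j)
    rw [Finset.card_univ, Fintype.card_fun, Fintype.card_fin, Fintype.card_bool] at h1
    have h2 : ((Finset.univ.filter fun b => 8 * (D.m * (P + 1)) < ∑ j, E b j).card : ℝ) + G.card =
        2 ^ D.k := by exact_mod_cast h1
    have h3 : ((Finset.univ.filter fun b => 8 * (D.m * (P + 1)) < ∑ j, E b j).card : ℝ) * 8 *
        (D.m * (P + 1)) ≤ 2 ^ D.k * (D.m * (P + 1)) := by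
      have : 0 ≤ 2 ^ D.k * (D.m : ℝ) := by positivity
      nlinarith
    have h4 := le_of_mul_le_mul_right h3 (by positivity)
    linarith
  -- High-energy uses keep the true law, so their cost `t` is zero; the others no longer depend on
  -- the message.
  let Q : (Fin D.k → Bool) → Fin D.m → Measure (Fin d → ℝ) := fun b j =>
    if j ∈ H then Measure.pi fun a => gaussianReal (D.enc b j a) v
    else Measure.pi fun _ => gaussianReal 0 (v / 2)
  let Q0 : Fin D.m → Measure (Fin d → ℝ) := fun j =>
    if j ∈ H then Measure.pi fun _ => gaussianReal 0 ((1 + α) * v)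
    else Measure.pi fun _ => gaussianReal 0 (v / 2)
  have hQ : ∀ b j, IsProbabilityMeasure (Q b j) := fun b j => by
    by_cases hj : j ∈ H <;> simp only [Q, hj, if_true, if_false] <;> infer_instance
  have hQ0 : ∀ j, IsProbabilityMeasure (Q0 j) := fun j => by
    by_cases hj : j ∈ H <;> simp only [Q0, hj, if_true, if_false] <;> infer_instance
  -- Both `T` and `α` are proportional to `P + 1` up to fixed factors, whence the quadratic growth
  -- in the power.
  have hτ : d + 8192 * d * (P + 1) ^ 2 / ((σ2 / d) * R) ^ 2 = d + T / v := by
    simp only [T, hα, ← hvr]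
    field_simp
    ring
  rw [hτ]
  refine D.errorProb_lower_bound hσ Q Q0 (fun b j => if j ∈ H then 0 else d + E b j / v)
    ?_ ?_ (by positivity) ?_ G hG ?_
  · intro b j
    have := hE b j
    split_ifs <;> positivity
  · intro b j
    by_cases hj : j ∈ H
    · simp only [Q, hj, if_true, Real.exp_zero, ENNReal.ofReal_one, one_smul]
      exact le_refl _
    · simp only [Q, hj, if_false]
      exact pi_gaussianReal_zero_half_le hv (D.enc b j)
  · intro j
    by_cases hj : j ∈ H
    · simp only [hj, if_true, Finset.sum_const_zero]
      positivity
    · simp only [hj, if_false]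
      have hj' : ∑ b, E b j ≤ T * 2 ^ D.k := by
        simpa [H] using hj
      rw [Finset.sum_add_distrib, ← Finset.sum_div, mul_add]
      refine add_le_add (by simp) ?_
      rw [← mul_div_assoc, mul_comm _ T]
      gcongr
  · intro b hb
    have h1 : Measure.pi (Q b) ≤ ENNReal.ofReal (Real.exp
        (∑ j, if j ∈ H then d * (α / 2 : ℝ) + E b j / (2 * α * v) else 0)) • Measure.pi Q0 := by
      refine pi_le_ofReal_exp_smul_pi _ _ _ fun j => ?_
      by_cases hj : j ∈ H
      · simp only [Q, Q0, hj, if_true]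
        exact pi_gaussianReal_le_zero_mul hv hα' (D.enc b j)
      · simp [Q, Q0, hj]
    refine h1.trans (Measure.le_iff.2 fun A _ => ?_)
    rw [Measure.smul_apply, Measure.smul_apply]
    refine smul_le_smul_of_nonneg_right (ENNReal.ofReal_le_ofReal (Real.exp_le_exp.2 ?_)) zero_le
    rw [Finset.sum_ite_mem, Finset.univ_inter, Finset.sum_add_distrib, Finset.sum_const,
      nsmul_eq_mul, ← Finset.sum_div]
    have h2 : ∑ j ∈ H, E b j ≤ 8 * (D.m * (P + 1)) :=
      (Finset.sum_le_univ_sum_of_nonneg (hE b)).trans (not_lt.1 (Finset.mem_filter.1 hb).2)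
    have h3 : (∑ j ∈ H, E b j) / (2 * α * v) ≤ R * D.m / 64 := by
      rw [div_le_iff₀ (by positivity)]
      refine h2.trans (le_of_eq ?_)
      rw [hα]
      field_simp
      norm_num
    rw [hk]
    linarith

/-- The neighborhood size needed at error probability `ε` is of order `log (1 / ε)`, with a
constant that deteriorates polynomially in the received power. -/
theorem exists_le_exp_mul_errorProb (K : ChannelKind) {d : ℕ} (hd : 1 ≤ d) (ζ : ℕ) {σ2 R : ℝ}
    (hσ : 0 < σ2) (hR : 0 < R) :
    ∃ A : ℝ, 1 ≤ A ∧ ∀ D : Design K d ζ, D.rate = R →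
      1 / 512 ≤ Real.exp (512 * (D.nbhd * (A * (D.PR + 1) ^ 2) + 1)) * D.errorProb σ2 := by
  have key : ∀ {n a b e : ℝ}, 0 ≤ n → 0 ≤ e → a ≤ b → 1 / 512 ≤ Real.exp (512 * (n * a + 1)) * e →
      1 / 512 ≤ Real.exp (512 * (n * b + 1)) * e := fun hn he hab h => h.trans (by gcongr)
  have hd0 : (1 : ℝ) ≤ d := by exact_mod_cast hd
  have he : ∀ D : Design K d ζ, 0 ≤ D.errorProb σ2 := fun D =>
    div_nonneg (Finset.sum_nonneg fun i _ => div_nonneg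
      (Finset.sum_nonneg fun b _ => measureReal_nonneg) (by positivity)) (by positivity)
  cases K with
  | bsc =>
    refine ⟨d * (1 / σ2 + 2), ?_, fun D _ => ?_⟩
    · have : 0 < 1 / σ2 := by positivity
      nlinarith
    · refine key (by positivity) (he D) ?_ (D.errorProb_lower_bound_bsc hσ)
      have hP : (0 : ℝ) ≤ D.PR := D.PR.2
      rw [mul_assoc]
      gcongr
      have h1 : 0 < 1 / σ2 := by positivity
      have h2 : (D.PR : ℝ) / σ2 = 1 / σ2 * D.PR := by ring
      rw [h2]
      have h3 : 0 ≤ 1 / σ2 * (D.PR : ℝ) := by positivity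
      have h4 : 0 ≤ 1 / σ2 * (D.PR : ℝ) ^ 2 := by positivity
      nlinarith
  | awgn =>
    refine ⟨d + 8192 * d / ((σ2 / d) * R) ^ 2, ?_, fun D hD => ?_⟩
    · have : 0 < 8192 * d / ((σ2 / d) * R) ^ 2 := by positivity
      linarith
    · refine key (by positivity) (he D) ?_ (D.errorProb_lower_bound_awgn hd hσ hR hD)
      have hP : (0 : ℝ) ≤ D.PR := D.PR.2
      rw [add_mul, mul_div_right_comm]
      refine add_le_add_left ?_ _
      exact le_mul_of_one_le_right (by positivity) (one_le_pow₀ (by linarith))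

/-! ### From error exponents to iterations and power -/

theorem logb_two_one_div_le {n B ε : ℝ} (hn : 0 ≤ n) (hB : 0 ≤ B) (hε : 0 < ε)
    (h : 1 / 512 ≤ Real.exp (512 * (n * B + 1)) * ε) :
    Real.logb 2 (1 / ε) ≤ 1033 + 1024 * (n * B) := by
  have h1 : 1 / ε ≤ 2 ^ 9 * Real.exp (512 * (n * B + 1)) := by
    rw [div_le_iff₀ hε]
    linarith
  have hl2 : 0 < Real.log 2 := Real.log_pos one_lt_two
  have h2 : 1 / 2 < Real.log 2 := by linarith [Real.log_two_gt_d9]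
  have h3 := Real.log_le_log (by positivity) h1
  rw [Real.log_mul (by positivity) (by positivity), Real.log_exp, Real.log_pow] at h3
  rw [Real.logb, div_le_iff₀ hl2]
  have hnB : 0 ≤ n * B := by positivity
  push_cast at h3
  nlinarith

theorem two_le_max_three_sub_one (ζ : ℕ) : (2 : ℝ) ≤ max (ζ : ℝ) 3 - 1 := by
  linarith [le_max_right (ζ : ℝ) 3]

theorem one_le_logb_max_three_sub_one (ζ : ℕ) : 1 ≤ Real.logb 2 (max (ζ : ℝ) 3 - 1) := by
  have h := two_le_max_three_sub_one ζ
  rw [Real.le_logb_iff_rpow_le one_lt_two (by linarith)]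
  simpa using h

theorem one_lt_logb_two_one_div {ε : ℝ} (hε : 0 < ε) (hε2 : ε < 1 / 2) :
    1 < Real.logb 2 (1 / ε) := by
  rw [Real.lt_logb_iff_rpow_lt one_lt_two (by positivity), Real.rpow_one, lt_div_iff₀ hε]
  linarith

theorem loglog_div_sub_le {ζ l : ℕ} {n A P ε : ℝ} (hn : 0 ≤ n) (hA : 1 ≤ A) (hP : 0 ≤ P)
    (hε : 0 < ε) (hε2 : ε < 1 / 2) (hnl : n ≤ 4 * (max (ζ : ℝ) 3 - 1) ^ l)
    (h : 1 / 512 ≤ Real.exp (512 * (n * (A * (P + 1) ^ 2) + 1)) * ε) :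
    Real.logb 2 (Real.logb 2 (1 / ε)) / Real.logb 2 (max (ζ : ℝ) 3 - 1) -
      Real.logb 2 (5129 * A) - 2 * Real.logb 2 (P + 1) ≤ l := by
  set q : ℝ := max (ζ : ℝ) 3 - 1 with hq
  have hq2 : 2 ≤ q := two_le_max_three_sub_one ζ
  have hL : 1 ≤ Real.logb 2 q := one_le_logb_max_three_sub_one ζ
  have hx := one_lt_logb_two_one_div hε hε2
  have hB : 1 ≤ A * (P + 1) ^ 2 :=
    one_le_mul_of_one_le_of_one_le hA (one_le_pow₀ (by linarith))
  have hql : 1 ≤ q ^ l := one_le_pow₀ (by linarith)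
  -- The constant is `5129 = 1033 + 4 * 1024`, the 4 coming from the ball bound.
  have h1 : Real.logb 2 (1 / ε) ≤ 5129 * A * (P + 1) ^ 2 * q ^ l := by
    refine (logb_two_one_div_le hn (by positivity) hε h).trans ?_
    have h2 : n * (A * (P + 1) ^ 2) ≤ 4 * q ^ l * (A * (P + 1) ^ 2) := by gcongr
    have h3 : 1 ≤ A * (P + 1) ^ 2 * q ^ l := one_le_mul_of_one_le_of_one_le hB hql
    linarith
  have hq0 : 0 < q := by linarith
  have hP1 : 0 < P + 1 := by linarith
  have h2 := Real.logb_le_logb_of_le one_lt_two (by linarith) h1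
  rw [Real.logb_mul (by positivity) (by positivity), Real.logb_mul (by positivity) (by positivity),
    Real.logb_pow, Real.logb_pow] at h2
  have h3 : 0 ≤ Real.logb 2 (5129 * A) := Real.logb_nonneg one_lt_two (by linarith)
  have h4 : 0 ≤ Real.logb 2 (P + 1) := Real.logb_nonneg one_lt_two (by linarith)
  have h5 : Real.logb 2 (Real.logb 2 (1 / ε)) / Real.logb 2 q ≤
      (Real.logb 2 (5129 * A) + 2 * Real.logb 2 (P + 1)) / Real.logb 2 q + l := by
    rw [div_le_iff₀ (by linarith), add_mul, div_mul_cancel₀ _ (by linarith)]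
    exact_mod_cast h2
  have h6 : (Real.logb 2 (5129 * A) + 2 * Real.logb 2 (P + 1)) / Real.logb 2 q ≤
      Real.logb 2 (5129 * A) + 2 * Real.logb 2 (P + 1) := div_le_self (by linarith) hL
  linarith

theorem Design.nbhd_le {K : ChannelKind} {d ζ : ℕ} (D : Design K d ζ) :
    (D.nbhd : ℝ) ≤ 4 * (max (ζ : ℝ) 3 - 1) ^ D.iters := by
  have h : ((D.dec.maxNeighborhood D.iters : ℕ) : ℝ) ≤ ((4 * (max ζ 3 - 1) ^ D.iters : ℕ) : ℝ) :=
    Nat.cast_le.2 (D.dec.maxNeighborhood_le D.iters)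
  rw [Nat.cast_mul, Nat.cast_pow, Nat.cast_sub (le_trans (by norm_num) (le_max_right ζ 3)),
    Nat.cast_max] at h
  exact_mod_cast h

/-- There are at least `m` processing elements, since each stores at most one output, and `m = k /
R`. -/
theorem Design.mul_iters_le_decodingPower {K : ChannelKind} {d ζ : ℕ} {R Enode Rdec : ℝ}
    (hE : 0 < Enode) (hRdec : 0 < Rdec) (D : Design K d ζ) (hrate : D.rate = R) :
    Enode * Rdec / R * D.iters ≤ D.decodingPower Enode Rdec := by
  have hm : (D.m : ℝ) ≤ Nat.card D.dec.PE := by exact_mod_cast D.dec.le_card_PE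
  have hk0 : (0 : ℝ) < D.k := by exact_mod_cast D.k_pos
  have hm0 : (0 : ℝ) < D.m := by exact_mod_cast D.m_pos
  rw [← hrate, Design.rate, Design.decodingPower]
  calc Enode * Rdec / (D.k / D.m) * D.iters = Enode * D.m * D.iters / (D.k / Rdec) := by
        field_simp
    _ ≤ _ := by gcongr

theorem tendsto_nhds_top_of_ofReal_le {l : Filter ℝ} {f : ℝ → ℝ≥0∞} {g : ℝ → ℝ}
    (hg : Tendsto g l atTop) (h : ∀ᶠ ε in l, ENNReal.ofReal (g ε) ≤ f ε) :
    Tendsto f l (𝓝 ⊤) :=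
  tendsto_nhds_top_mono (ENNReal.tendsto_ofReal_nhds_top.2 hg) h

theorem tendsto_logb_one_div : Tendsto (fun ε : ℝ => Real.logb 2 (1 / ε)) (𝓝[>] 0) atTop := by
  simp_rw [one_div]
  exact (Real.tendsto_logb_atTop one_lt_two).comp tendsto_inv_nhdsGT_zero

theorem tendsto_mul_sub_atTop {l : Filter ℝ} {g : ℝ → ℝ} (hg : Tendsto g l atTop) {c : ℝ}
    (hc : 0 < c) (C : ℝ) : Tendsto (fun ε => c * g ε - C) l atTop :=
  tendsto_atTop_add_const_right _ (-C) (hg.const_mul_atTop hc)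

theorem tendsto_loglog_div_atTop (ζ : ℕ) :
    Tendsto (fun ε : ℝ => Real.logb 2 (Real.logb 2 (1 / ε)) /
      Real.logb 2 (max (ζ : ℝ) 3 - 1)) (𝓝[>] 0) atTop :=
  ((Real.tendsto_logb_atTop one_lt_two).comp tendsto_logb_one_div).atTop_div_const
    (zero_lt_one.trans_le (one_le_logb_max_three_sub_one ζ))

/-- This is `log u ≤ u - 1` at `u = ξ / (4 * κ) * (P + 1)`, scaled so that the tangent has slope
exactly `ξ` in `P` after `logb 2` is bounded by `2 * log`. -/
theorem two_mul_logb_le {κ ξ P : ℝ} (hκ : 0 < κ) (hξ : 0 < ξ) (hP : 0 ≤ P) :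
    κ * (2 * Real.logb 2 (P + 1)) ≤ ξ * P + (ξ - 4 * κ - 4 * κ * Real.log (ξ / (4 * κ))) := by
  have hP1 : 0 < P + 1 := by linarith
  have h1 := Real.log_le_sub_one_of_pos (show 0 < ξ / (4 * κ) * (P + 1) by positivity)
  rw [Real.log_mul (by positivity) (by positivity)] at h1
  have h2 : Real.logb 2 (P + 1) ≤ 2 * Real.log (P + 1) := by
    have hl : 0 ≤ Real.log (P + 1) := Real.log_nonneg (by linarith)
    have h3 : 1 / 2 < Real.log 2 := by linarith [Real.log_two_gt_d9]
    rw [Real.logb, div_le_iff₀ (by linarith)]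
    nlinarith
  have h4 : κ * (ξ / (4 * κ) * (P + 1)) = ξ * (P + 1) / 4 := by field_simp
  have h5 := mul_le_mul_of_nonneg_left h1 hκ.le
  have h6 := mul_le_mul_of_nonneg_left h2 hκ.le
  have h7 : κ * (ξ / (4 * κ) * (P + 1) - 1) = ξ * (P + 1) / 4 - κ := by rw [mul_sub, h4, mul_one]
  rw [h7] at h5
  linarith

theorem eventually_small_error : ∀ᶠ ε : ℝ in 𝓝[>] 0, 0 < ε ∧ ε < 1 / 2 :=
  Ioo_mem_nhdsGT (by norm_num)

theorem mainTheorem2 (K : ChannelKind) (d ζ : ℕ) (hd : 1 ≤ d)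
    (σ2 R ξT ξD Enode Rdec : ℝ) (hσ : 0 < σ2) (hR : 0 < R) (hξT : 0 < ξT) (hξD : 0 < ξD)
    (hE : 0 < Enode) (hRdec : 0 < Rdec) :
    (∀ PT : ℝ, 0 ≤ PT →
      (Tendsto (fun ε => requiredNeighborhood K d ζ σ2 R ξT PT ε) (𝓝[>] 0) (𝓝 ⊤) ∧
        Tendsto (fun ε => requiredIterations K d ζ σ2 R ξT PT ε) (𝓝[>] 0) (𝓝 ⊤) ∧
        Tendsto (fun ε => requiredDecodingPower K d ζ σ2 R ξT Enode Rdec PT ε)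
          (𝓝[>] 0) (𝓝 ⊤)) ∧
      (∃ c C : ℝ, 0 < c ∧ ∀ ε : ℝ, 0 < ε → ε < 1 / 2 →
        ENNReal.ofReal (c * Real.logb 2 (1 / ε) - C) ≤
          requiredNeighborhood K d ζ σ2 R ξT PT ε) ∧
      (∃ C : ℝ, ∀ ε : ℝ, 0 < ε → ε < 1 / 2 →
        ENNReal.ofReal
            (Real.logb 2 (Real.logb 2 (1 / ε)) / Real.logb 2 (max (ζ : ℝ) 3 - 1) - C) ≤
          requiredIterations K d ζ σ2 R ξT PT ε) ∧
      (∃ C : ℝ, ∀ ε : ℝ, 0 < ε → ε < 1 / 2 →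
        ENNReal.ofReal
            (Enode * Rdec / R *
              (Real.logb 2 (Real.logb 2 (1 / ε)) / Real.logb 2 (max (ζ : ℝ) 3 - 1)) - C) ≤
          requiredDecodingPower K d ζ σ2 R ξT Enode Rdec PT ε)) ∧
    Tendsto (fun ε => minTotalPower K d ζ σ2 R ξT ξD Enode Rdec ε) (𝓝[>] 0) (𝓝 ⊤) ∧
    (∃ C : ℝ, ∀ ε : ℝ, 0 < ε → ε < 1 / 2 →
      ENNReal.ofReal
          (ξD * Enode * Rdec / R *
            (Real.logb 2 (Real.logb 2 (1 / ε)) / Real.logb 2 (max (ζ : ℝ) 3 - 1)) - C) ≤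
        minTotalPower K d ζ σ2 R ξT ξD Enode Rdec ε) := by
  obtain ⟨A, hA, hmain⟩ := exists_le_exp_mul_errorProb K hd ζ hσ hR
  have hbound : ∀ D : Design K d ζ, D.rate = R → ∀ ε, D.errorProb σ2 ≤ ε →
      1 / 512 ≤ Real.exp (512 * (D.nbhd * (A * (D.PR + 1) ^ 2) + 1)) * ε := fun D hD ε hε =>
    (hmain D hD).trans (by gcongr)
  have hiter : ∀ D : Design K d ζ, D.rate = R → ∀ ε, 0 < ε → ε < 1 / 2 → D.errorProb σ2 ≤ ε →
      Real.logb 2 (Real.logb 2 (1 / ε)) / Real.logb 2 (max (ζ : ℝ) 3 - 1) -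
        Real.logb 2 (5129 * A) - 2 * Real.logb 2 (D.PR + 1) ≤ D.iters :=
    fun D hD ε hε hε2 he => loglog_div_sub_le (by positivity) hA D.PR.2 hε hε2 D.nbhd_le
      (hbound D hD ε he)
  have hLL := tendsto_loglog_div_atTop ζ
  refine ⟨fun PT hPT => ?_, ?_⟩
  · have hPR : ∀ D : Design K d ζ, D.transmitPower ξT ≤ PT → (D.PR : ℝ) ≤ PT / ξT := fun D h => by
      rw [le_div_iff₀ hξT, mul_comm]
      exact h
    have hPTξ : 0 ≤ PT / ξT := by positivity
    set B : ℝ := A * (PT / ξT + 1) ^ 2 with hB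
    have hB0 : 0 < B := by positivity
    set C : ℝ := Real.logb 2 (5129 * A) + 2 * Real.logb 2 (PT / ξT + 1)
    have hn : ∀ ε : ℝ, 0 < ε → ε < 1 / 2 →
        ENNReal.ofReal (1 / (1024 * B) * Real.logb 2 (1 / ε) - 1033 / (1024 * B)) ≤
          requiredNeighborhood K d ζ σ2 R ξT PT ε := by
      intro ε hε _
      refine le_iInf₂ fun D hD => le_iInf₂ fun he hP => ENNReal.ofReal_le_ofReal ?_
      have h1 := logb_two_one_div_le (n := D.nbhd) (B := B) (by positivity) hB0.le hε
        ((hbound D hD ε he).trans (by have := hPR D hP; rw [hB]; gcongr))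
      rw [div_mul_eq_mul_div, one_mul, ← sub_div, div_le_iff₀ (by positivity)]
      linarith
    have hl : ∀ ε : ℝ, 0 < ε → ε < 1 / 2 → ∀ D : Design K d ζ, D.rate = R → D.errorProb σ2 ≤ ε →
        D.transmitPower ξT ≤ PT →
        Real.logb 2 (Real.logb 2 (1 / ε)) / Real.logb 2 (max (ζ : ℝ) 3 - 1) - C ≤ D.iters := by
      intro ε hε hε2 D hD he hP
      have h1 := hiter D hD ε hε hε2 he
      have h2 : Real.logb 2 (D.PR + 1) ≤ Real.logb 2 (PT / ξT + 1) :=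
        Real.logb_le_logb_of_le one_lt_two (by positivity) (by linarith [hPR D hP])
      simp only [C]
      linarith
    have hi : ∀ ε : ℝ, 0 < ε → ε < 1 / 2 → ENNReal.ofReal
        (Real.logb 2 (Real.logb 2 (1 / ε)) / Real.logb 2 (max (ζ : ℝ) 3 - 1) - C) ≤
          requiredIterations K d ζ σ2 R ξT PT ε := fun ε hε hε2 =>
      le_iInf₂ fun D hD => le_iInf₂ fun he hP => ENNReal.ofReal_le_ofReal (hl ε hε hε2 D hD he hP)
    have hp : ∀ ε : ℝ, 0 < ε → ε < 1 / 2 → ENNReal.ofReal (Enode * Rdec / R *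
        (Real.logb 2 (Real.logb 2 (1 / ε)) / Real.logb 2 (max (ζ : ℝ) 3 - 1)) -
          Enode * Rdec / R * C) ≤ requiredDecodingPower K d ζ σ2 R ξT Enode Rdec PT ε := by
      intro ε hε hε2
      refine le_iInf₂ fun D hD => le_iInf₂ fun he hP => ENNReal.ofReal_le_ofReal ?_
      refine le_trans ?_ (D.mul_iters_le_decodingPower hE hRdec hD)
      rw [← mul_sub]
      have := hl ε hε hε2 D hD he hP
      gcongr
    refine ⟨⟨?_, ?_, ?_⟩, ⟨_, _, by positivity, hn⟩, ⟨_, hi⟩, ⟨_, hp⟩⟩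
    · exact tendsto_nhds_top_of_ofReal_le
        (tendsto_mul_sub_atTop tendsto_logb_one_div (by positivity) _)
        (eventually_small_error.mono fun ε h => hn ε h.1 h.2)
    · exact tendsto_nhds_top_of_ofReal_le (tendsto_atTop_add_const_right _ (-C) hLL)
        (eventually_small_error.mono fun ε h => hi ε h.1 h.2)
    · exact tendsto_nhds_top_of_ofReal_le (tendsto_mul_sub_atTop hLL (by positivity) _)
        (eventually_small_error.mono fun ε h => hp ε h.1 h.2)
  · set κ : ℝ := ξD * Enode * Rdec / R with hκ
    have hκ0 : 0 < κ := by positivity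
    -- The transmit term `ξT * PR` pays for the power-dependent loss in the iteration bound, leaving
    -- a constant independent of the design.
    set C : ℝ := κ * Real.logb 2 (5129 * A) +
      (ξT - 4 * κ - 4 * κ * Real.log (ξT / (4 * κ)))
    have ht : ∀ ε : ℝ, 0 < ε → ε < 1 / 2 → ENNReal.ofReal (κ *
        (Real.logb 2 (Real.logb 2 (1 / ε)) / Real.logb 2 (max (ζ : ℝ) 3 - 1)) - C) ≤
          minTotalPower K d ζ σ2 R ξT ξD Enode Rdec ε := by
      intro ε hε hε2
      refine le_iInf₂ fun D hD => le_iInf fun he => ENNReal.ofReal_le_ofReal ?_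
      have h1 := mul_le_mul_of_nonneg_left (hiter D hD ε hε hε2 he) hκ0.le
      have h2 := two_mul_logb_le hκ0 hξT D.PR.2
      have h3 := mul_le_mul_of_nonneg_left (D.mul_iters_le_decodingPower hE hRdec hD) hξD.le
      have h4 : ξD * (Enode * Rdec / R * D.iters) = κ * D.iters := by rw [hκ]; ring
      rw [h4] at h3
      rw [mul_sub, mul_sub] at h1
      change _ ≤ ξT * (D.PR : ℝ) + _
      change κ * (2 * Real.logb 2 ((D.PR : ℝ) + 1)) ≤ ξT * (D.PR : ℝ) + _ at h2
      simp only [C]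
      linarith
    exact ⟨tendsto_nhds_top_of_ofReal_le (tendsto_mul_sub_atTop hLL hκ0 _)
        (eventually_small_error.mono fun ε h => ht ε h.1 h.2), _, ht⟩
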